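/- Let $\mathbb{K}$ be $\mathbb{R}$ or $\mathbb{C}$. For every $\delta\in(1/2,1)$, every bounded measurable function $f:\mathbb{R}\to\mathbb{K}$ and every $x\in\mathbb{R}$, the double integral $$\int_{\mathbb{R}^2}\frac{e^{-\delta u}f(u)}{(e^{e^{x-u-t}}+1)(e^{e^t}+1)}\,du\,dt$$ converges absolutely. The Riemann hypothesis (every zero of the Riemann zeta-function other than $-2,-4,-6,\dots$ has real part $1/2$) is true if and only if, for every $\delta\in(1/2,1)$, every bounded measurable function $f:\mathbb{R}\to\mathbb{K}$ satisfying $$\int_{\mathbb{R}^2}\frac{e^{-\delta u}f(u)}{(e^{e^{x-u-t}}+1)(e^{e^t}+1)}\,du\,dt=0\qquad\text{for all }x\in\mathbb{R}$$ is zero almost everywhere. -/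

import Mathlib

/-- The integrand, without the factor `f u`, of the Salem-type integral equation:
`e^{-δ u} / ((e^{e^{x-u-t}} + 1) (e^{e^t} + 1))`. -/
noncomputable def salemWeight (δ x u t : ℝ) : ℝ :=
  Real.exp (-δ * u) /
    ((Real.exp (Real.exp (x - u - t)) + 1) * (Real.exp (Real.exp t) + 1))

open MeasureTheory Complex FourierTransform Filter Topology Set
open scoped ContDiff SchwartzMap

/-! Write b(u) = e^{-δu} / (e^{e^{-u}} + 1). The double integral is e^{-δx} times the result of
correlating f with b twice. The Fourier transform of b at ξ is the Mellin transform of 1/(e^t + 1)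
at s = δ + 2πiξ, that is Γ(s)(1 - 2^{1-s})ζ(s), and for 0 < Re s < 1 only ζ can make it vanish.

If ζ has no zero on Re s = δ, Wiener's theorem (`ae_eq_zero_of_correlation_eq_zero`) removes the two
correlations in turn, so f = 0. If ζ(z) = 0 with Re z = δ, then b annihilates a character of
frequency Im z, and its real part, a cosine, is a nonzero bounded solution over either field. By the
functional equation, RH only concerns zeros with 1/2 < Re s < 1. -/

/-! ### Fourier analysis and Wiener's theorem -/

/-- The Fourier transform is self-adjoint on integrable functions. -/
theorem integral_fourier_mul_eq_of_integrable {f g : ℝ → ℂ} (hf : Integrable f)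
    (hg : Integrable g) : ∫ ξ, 𝓕 f ξ * g ξ = ∫ x, f x * 𝓕 g x := by
  simpa using! VectorFourier.integral_bilin_fourierIntegral_eq_flip (ContinuousLinearMap.mul ℂ ℂ)
    (L := innerₗ ℝ) Real.continuous_fourierChar continuous_inner hf hg

/-- An integrable function on the line with vanishing Fourier transform is zero. -/
theorem ae_eq_zero_of_fourier_eq_zero {G : ℝ → ℂ} (hG : Integrable G) (h : ∀ ξ, 𝓕 G ξ = 0) :
    ∀ᵐ x, G x = 0 := by
  refine ae_eq_zero_of_integral_contDiff_smul_eq_zero hG.locallyIntegrable fun g hg hgc ↦ ?_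
  have hg₁ : HasCompactSupport (Complex.ofRealCLM ∘ g) := hgc.comp_left rfl
  have hg₂ : ContDiff ℝ ∞ (Complex.ofRealCLM ∘ g) := by fun_prop
  set s : 𝓢(ℝ, ℂ) := hg₁.toSchwartzMap hg₂
  have key := integral_fourier_mul_eq_of_integrable hG (𝓕⁻ s : 𝓢(ℝ, ℂ)).integrable
  have h2 : 𝓕 (⇑(𝓕⁻ s : 𝓢(ℝ, ℂ))) = ⇑s := by
    rw [← SchwartzMap.fourier_coe, FourierTransform.fourier_fourierInv_eq]
  rw [h2] at key
  simp only [h, zero_mul, integral_zero] at key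
  rw [key]
  refine integral_congr_ae (ae_of_all _ fun x ↦ ?_)
  simp [s, mul_comm]

/-- `∫ e^{2πiuξ} ψ(ξ) 𝓕 b(ξ) dξ` is the convolution of `b` with the inverse Fourier
transform of `ψ`. -/
theorem fourierInv_mul_fourier {b ψ : ℝ → ℂ} (hb : Integrable b) (hψ : Integrable ψ) (u : ℝ) :
    𝓕⁻ (fun ξ ↦ ψ ξ * 𝓕 b ξ) u = ∫ s, 𝓕⁻ ψ s * b (u - s) := by
  have h1 : Integrable fun ξ : ℝ ↦ cexp (↑(2 * Real.pi * (ξ * u)) * I) * ψ ξ := by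
    refine hψ.bdd_mul (c := 1) (by fun_prop) (ae_of_all _ fun ξ ↦ ?_)
    rw [Complex.norm_exp_ofReal_mul_I]
  have key := integral_fourier_mul_eq_of_integrable hb h1
  have h2 : ∀ v, 𝓕 (fun ξ : ℝ ↦ cexp (↑(2 * Real.pi * (ξ * u)) * I) * ψ ξ) v = 𝓕⁻ ψ (u - v) := by
    intro v
    rw [Real.fourier_eq', Real.fourierInv_eq']
    refine integral_congr_ae (ae_of_all _ fun ξ ↦ ?_)
    simp only [smul_eq_mul, ← mul_assoc, ← Complex.exp_add]
    congr 2
    simp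
    ring
  simp only [h2] at key
  rw [← integral_sub_left_eq_self (fun v ↦ b v * 𝓕⁻ ψ (u - v)) _ u] at key
  simp only [sub_sub_cancel] at key
  rw [Real.fourierInv_eq']
  convert key using 1
  · refine integral_congr_ae (ae_of_all _ fun ξ ↦ ?_)
    simp
    ring_nf
  · simp only [mul_comm]

/-- Correlating a bounded function and an integrable kernel, then integrating against an
integrable function. -/
theorem integral_mul_convolution {f b Ψ : ℝ → ℂ} (hf : Measurable f) {C : ℝ}
    (hC : ∀ u, ‖f u‖ ≤ C) (hb : Integrable b) (hΨ : Integrable Ψ) :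
    ∫ u, f u * ∫ s, Ψ s * b (u - s) = ∫ s, Ψ s * ∫ u, f u * b (u - s) := by
  have h1 : Integrable (fun p : ℝ × ℝ ↦ Ψ p.2 * b (p.1 - p.2)) (volume.prod volume) :=
    hΨ.convolution_integrand (ContinuousLinearMap.mul ℂ ℂ) hb
  have h2 : Integrable (fun p : ℝ × ℝ ↦ f p.1 * (Ψ p.2 * b (p.1 - p.2)))
      (volume.prod volume) :=
    h1.bdd_mul (c := C) (hf.comp measurable_fst).aestronglyMeasurable
      (ae_of_all _ fun p ↦ hC p.1)
  simp_rw [← integral_const_mul]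
  rw [integral_integral_swap h2]
  simp_rw [mul_left_comm]

/-- A special case of **Wiener's Tauberian theorem**: if the Fourier transform of the integrable
kernel `b` is smooth and has no zeros, then a bounded function whose correlation with `b`
vanishes is zero. -/
theorem ae_eq_zero_of_correlation_eq_zero {f b : ℝ → ℂ} (hf : Measurable f) {C : ℝ}
    (hC : ∀ u, ‖f u‖ ≤ C) (hb : Integrable b) (hsm : ContDiff ℝ ∞ (𝓕 b))
    (hne : ∀ ξ, 𝓕 b ξ ≠ 0) (h : ∀ᵐ x, ∫ u, f u * b (u - x) = 0) : ∀ᵐ u, f u = 0 := by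
  -- Since 𝓕 b is smooth and zero-free, φ / 𝓕 b is again a test function, so 𝓕⁻ φ is a convolution
  -- with b.
  have test : ∀ φ : ℝ → ℂ, ContDiff ℝ ∞ φ → HasCompactSupport φ → ∫ u, f u * 𝓕⁻ φ u = 0 := by
    intro φ hφ hφc
    have hψ₁ : HasCompactSupport fun ξ ↦ φ ξ * (𝓕 b ξ)⁻¹ := hφc.mul_right
    have hψ₂ : ContDiff ℝ ∞ fun ξ ↦ φ ξ * (𝓕 b ξ)⁻¹ := hφ.mul (hsm.inv hne)
    set s : 𝓢(ℝ, ℂ) := hψ₁.toSchwartzMap hψ₂ with hs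
    have e : φ = fun ξ ↦ s ξ * 𝓕 b ξ := by
      ext ξ
      simp [hs, hne ξ]
    have h3 : Integrable (𝓕⁻ (s : ℝ → ℂ)) := by
      rw [← SchwartzMap.fourierInv_coe]
      exact (𝓕⁻ s : 𝓢(ℝ, ℂ)).integrable
    rw [e]
    simp only [fourierInv_mul_fourier hb s.integrable]
    rw [integral_mul_convolution hf hC hb h3]
    refine integral_eq_zero_of_ae ?_
    filter_upwards [h] with x hx
    simp [hx]
  -- f need not be integrable, so it is multiplied by translates of a Schwartz window w whose
  -- transform is a bump; w(0) = ∫ β > 0.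
  let β : ContDiffBump (0 : ℝ) := ⟨1, 2, one_pos, one_lt_two⟩
  have hβc : HasCompactSupport fun η ↦ (β η : ℂ) := β.hasCompactSupport.comp_left ofReal_zero
  have hβs : ContDiff ℝ ∞ fun η ↦ (β η : ℂ) := Complex.ofRealCLM.contDiff.comp β.contDiff
  set B : 𝓢(ℝ, ℂ) := hβc.toSchwartzMap hβs with hB
  set w : 𝓢(ℝ, ℂ) := 𝓕⁻ B with hw
  have hw_apply : ∀ y, w y = ∫ η : ℝ, cexp (↑(2 * Real.pi * (η * y)) * I) * β η := by
    intro y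
    rw [hw, SchwartzMap.fourierInv_coe, Real.fourierInv_eq']
    simp [hB, mul_comm y]
  have hw0 : w 0 ≠ 0 := by
    rw [hw_apply]
    simp only [mul_zero, ofReal_zero, zero_mul, Complex.exp_zero, one_mul]
    rw [integral_complex_ofReal]
    exact_mod_cast β.integral_pos.ne'
  have shift : ∀ x ξ u : ℝ,
      𝓕⁻ (fun η : ℝ ↦ cexp (↑(-(2 * Real.pi * (η * x))) * I) * (β (η - ξ) : ℂ)) u =
        cexp (↑(2 * Real.pi * (ξ * (u - x))) * I) * w (u - x) := by
    intro x ξ u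
    rw [hw_apply, Real.fourierInv_eq', ← integral_const_mul, ← integral_add_right_eq_self _ ξ]
    refine integral_congr_ae (ae_of_all _ fun η ↦ ?_)
    simp only [smul_eq_mul, ← mul_assoc, ← Complex.exp_add, add_sub_cancel_right]
    congr 2
    simp
    ring
  have local_zero : ∀ x, ∀ᵐ u, f u * w (u - x) = 0 := by
    intro x
    refine ae_eq_zero_of_fourier_eq_zero ?_ fun ξ ↦ ?_
    · exact (w.integrable.comp_sub_right x).bdd_mul hf.aestronglyMeasurable (ae_of_all _ hC)
    · have := test (fun η : ℝ ↦ cexp (↑(-(2 * Real.pi * (η * x))) * I) * (β (η - (-ξ)) : ℂ))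
        (by
          refine ContDiff.mul ?_ (hβs.comp (contDiff_id.sub contDiff_const))
          exact (Complex.ofRealCLM.contDiff.comp (by fun_prop :
            ContDiff ℝ ∞ fun η : ℝ ↦ -(2 * Real.pi * (η * x)))).mul contDiff_const |>.cexp)
        ((hβc.comp_homeomorph (Homeomorph.subRight (-ξ))).mul_left)
      simp only [shift] at this
      have h5 : 𝓕 (fun u ↦ f u * w (u - x)) ξ = cexp (↑(-(2 * Real.pi * (ξ * x))) * I) *
          ∫ u, f u * (cexp (↑(2 * Real.pi * (-ξ * (u - x))) * I) * w (u - x)) := by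
        rw [Real.fourier_eq', ← integral_const_mul]
        refine integral_congr_ae (ae_of_all _ fun u ↦ ?_)
        simp only [smul_eq_mul]
        rw [mul_left_comm (f u), ← mul_assoc (cexp _) (cexp _), ← Complex.exp_add]
        congr 2
        simp
        ring
      rw [h5, this, mul_zero]
  obtain ⟨ε, hε, hball⟩ := Metric.eventually_nhds_iff_ball.mp
    (w.continuous.continuousAt.eventually_ne hw0)
  rw [ae_iff]
  refine measure_null_of_locally_null _ fun x _ ↦
    ⟨{u | f u ≠ 0} ∩ Metric.ball x ε, ?_, ?_⟩
  · exact inter_mem self_mem_nhdsWithin (mem_nhdsWithin_of_mem_nhds (Metric.ball_mem_nhds x hε))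
  · refine measure_mono_null ?_ (ae_iff.mp (local_zero x))
    rintro u ⟨hu, hux⟩
    have : w (u - x) ≠ 0 := hball _ (by simpa [Real.dist_eq] using hux)
    exact mul_ne_zero hu this

/-! ### Mellin transform of the Fermi function and ζ -/

/-- The Fermi function `1 / (e^s + 1)`, complex-valued. -/
noncomputable def fermi (s : ℝ) : ℂ := ((1 / (Real.exp s + 1) : ℝ) : ℂ)

theorem continuous_fermi : Continuous fermi := by
  unfold fermi
  refine continuous_ofReal.comp (continuous_const.div (by fun_prop) fun s ↦ ?_)
  positivity

theorem fermi_isBigO_atTop : fermi =O[atTop] fun t : ℝ ↦ Real.exp (-1 * t) := by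
  refine Asymptotics.IsBigO.of_bound 1 (Eventually.of_forall fun t ↦ ?_)
  have h := Real.exp_pos t
  rw [fermi, norm_real, Real.norm_of_nonneg (by positivity), Real.norm_of_nonneg (by positivity),
    one_mul, neg_one_mul, Real.exp_neg, ← one_div]
  gcongr
  linarith

theorem fermi_isBigO_zero : fermi =O[𝓝[>] 0] fun t : ℝ ↦ t ^ (-(0 : ℝ)) := by
  refine Asymptotics.IsBigO.of_bound 1 (Eventually.of_forall fun t ↦ ?_)
  have h := Real.exp_pos t
  rw [fermi, norm_real, Real.norm_of_nonneg (by positivity)]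
  simp only [neg_zero, Real.rpow_zero, norm_one, mul_one]
  rw [div_le_one (by positivity)]
  linarith

theorem mellinConvergent_fermi {s : ℂ} (hs : 0 < s.re) : MellinConvergent fermi s :=
  mellinConvergent_of_isBigO_rpow_exp one_pos
    (continuous_fermi.locallyIntegrable.locallyIntegrableOn _) fermi_isBigO_atTop
    fermi_isBigO_zero hs

theorem differentiableAt_mellin_fermi {s : ℂ} (hs : 0 < s.re) :
    DifferentiableAt ℂ (mellin fermi) s :=
  mellin_differentiableAt_of_isBigO_rpow_exp one_pos
    (continuous_fermi.locallyIntegrable.locallyIntegrableOn _) fermi_isBigO_atTop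
    fermi_isBigO_zero hs

theorem hasSum_fermi {t : ℝ} (ht : 0 < t) :
    HasSum (fun n : ℕ ↦ (-1 : ℂ) ^ n * (Real.exp (-((n + 1 : ℕ) : ℝ) * t) : ℂ)) (fermi t) := by
  have h0 : ‖(-(Real.exp (-t)) : ℝ)‖ < 1 := by
    rw [norm_neg, Real.norm_of_nonneg (Real.exp_pos _).le, Real.exp_lt_one_iff]
    linarith
  have h1 := (hasSum_geometric_of_norm_lt_one h0).mul_left (Real.exp (-t))
  have h2 := Complex.hasSum_ofReal.mpr h1
  convert h2 using 1
  · ext n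
    rw [neg_pow (Real.exp (-t)), ← Real.exp_nat_mul, mul_left_comm, ← Real.exp_add]
    push_cast
    congr 2
    ring
  · rw [fermi, Real.exp_neg]
    have := Real.exp_pos t
    congr 1
    rw [sub_neg_eq_add]
    field_simp

theorem hasSum_nat_succ_cosZeta_half {s : ℂ} (hs : 1 < s.re) :
    HasSum (fun n : ℕ ↦ (-1 : ℂ) ^ (n + 1) / ((n + 1 : ℕ) : ℂ) ^ s)
      (HurwitzZeta.cosZeta ((1 / 2 : ℝ) : UnitAddCircle) s) := by
  have h := HurwitzZeta.hasSum_nat_cosZeta (1 / 2) hs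
  have hs0 : s ≠ 0 := by rintro rfl; simp at hs; linarith
  rw [← hasSum_nat_add_iff' 1] at h
  simp only [Finset.range_one, Finset.sum_singleton, CharP.cast_eq_zero, zero_cpow hs0, div_zero,
    sub_zero] at h
  refine h.congr_fun fun n ↦ ?_
  rw [show 2 * Real.pi * (1 / 2) * ((n + 1 : ℕ) : ℝ) = ((n + 1 : ℕ) : ℝ) * Real.pi by ring,
    Real.cos_nat_mul_pi]
  push_cast
  rfl

theorem half_unitAddCircle_ne_zero : ((1 / 2 : ℝ) : UnitAddCircle) ≠ 0 := by
  rw [Ne, AddCircle.coe_eq_zero_iff]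
  rintro ⟨n, hn⟩
  simp only [zsmul_eq_mul, mul_one] at hn
  have : (2 * n : ℝ) = 1 := by rw [hn]; norm_num
  norm_cast at this
  omega

/-- The Mellin transform of `1 / (e^s + 1)` in terms of the alternating zeta function. -/
theorem mellin_fermi_eq_cosZeta {s : ℂ} (hs : 0 < s.re) :
    mellin fermi s = -(Gamma s * HurwitzZeta.cosZeta ((1 / 2 : ℝ) : UnitAddCircle) s) := by
  have hU : IsOpen {z : ℂ | 0 < z.re} := isOpen_lt continuous_const continuous_re
  have hf : AnalyticOnNhd ℂ (mellin fermi) {z : ℂ | 0 < z.re} :=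
    DifferentiableOn.analyticOnNhd
      (fun z hz ↦ (differentiableAt_mellin_fermi hz).differentiableWithinAt) hU
  have hg : AnalyticOnNhd ℂ
      (fun z ↦ -(Gamma z * HurwitzZeta.cosZeta ((1 / 2 : ℝ) : UnitAddCircle) z))
      {z : ℂ | 0 < z.re} := by
    refine DifferentiableOn.analyticOnNhd (fun z hz ↦ ?_) hU
    refine DifferentiableAt.differentiableWithinAt (DifferentiableAt.neg (DifferentiableAt.mul ?_
      (HurwitzZeta.differentiable_cosZeta_of_ne_zero half_unitAddCircle_ne_zero z)))
    refine differentiableAt_Gamma z fun m hm ↦ ?_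
    have : 0 < z.re := hz
    rw [hm] at this
    simp at this
    linarith [(Nat.cast_nonneg m : (0 : ℝ) ≤ m)]
  -- Termwise integration needs Re s > 1; the identity theorem extends the formula to Re s > 0.
  refine hf.eqOn_of_preconnected_of_eventuallyEq hg (convex_halfSpace_re_gt 0).isPreconnected
    (show (2 : ℂ) ∈ {z : ℂ | 0 < z.re} by simp) ?_ hs
  have hV : IsOpen {z : ℂ | 1 < z.re} := isOpen_lt continuous_const continuous_re
  filter_upwards [hV.mem_nhds (show (2 : ℂ) ∈ {z : ℂ | 1 < z.re} by simp)] with z hz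
  replace hz : 1 < z.re := hz
  have h1 := hasSum_mellin (a := fun n : ℕ ↦ (-1 : ℂ) ^ n) (p := fun n : ℕ ↦ ((n + 1 : ℕ) : ℝ))
    (F := fermi) (s := z) (fun n ↦ Or.inr (by positivity)) (by linarith)
    (fun t ht ↦ hasSum_fermi ht) (by
      simp only [norm_pow, norm_neg, norm_one, one_pow]
      exact (summable_nat_add_iff 1).mpr (Real.summable_one_div_nat_rpow.mpr hz))
  refine h1.unique ?_
  rw [neg_eq_neg_one_mul (Gamma z * _)]
  refine (((hasSum_nat_succ_cosZeta_half hz).mul_left (Gamma z)).mul_left (-1)).congr_fun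
    fun n ↦ ?_
  push_cast
  ring

/-- For Re s > 1, adding ∑ n^{-s} to ∑ (-1)^n n^{-s} leaves twice the even terms, 2^{1-s} ζ(s);
continue analytically. -/
theorem cosZeta_half_eq {s : ℂ} (hs : s ≠ 1) :
    HurwitzZeta.cosZeta ((1 / 2 : ℝ) : UnitAddCircle) s =
      -((1 - 2 ^ (1 - s)) * riemannZeta s) := by
  have hU : IsOpen ({1}ᶜ : Set ℂ) := isOpen_compl_singleton
  have hf : AnalyticOnNhd ℂ (HurwitzZeta.cosZeta ((1 / 2 : ℝ) : UnitAddCircle)) {1}ᶜ :=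
    (HurwitzZeta.differentiable_cosZeta_of_ne_zero
      half_unitAddCircle_ne_zero).differentiableOn.analyticOnNhd hU
  have hg : AnalyticOnNhd ℂ (fun s ↦ -((1 - 2 ^ (1 - s)) * riemannZeta s)) {1}ᶜ := by
    refine DifferentiableOn.analyticOnNhd (fun z hz ↦ ?_) hU
    have h1 := differentiableAt_riemannZeta hz
    refine DifferentiableAt.differentiableWithinAt (DifferentiableAt.neg (DifferentiableAt.mul ?_ h1))
    exact (differentiableAt_const _).sub
      ((differentiableAt_id.const_sub 1).const_cpow (Or.inl two_ne_zero))
  refine hf.eqOn_of_preconnected_of_eventuallyEq hg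
    (isConnected_compl_singleton_of_one_lt_rank (by simp) 1).isPreconnected
    (show (2 : ℂ) ∈ ({1}ᶜ : Set ℂ) by simp) ?_ hs
  have hV : IsOpen {z : ℂ | 1 < z.re} := isOpen_lt continuous_const continuous_re
  filter_upwards [hV.mem_nhds (show (2 : ℂ) ∈ {z : ℂ | 1 < z.re} by simp)] with z hz
  replace hz : 1 < z.re := hz
  have h1 : HasSum (fun n : ℕ ↦ 1 / (n : ℂ) ^ z) (riemannZeta z) := by
    rw [zeta_eq_tsum_one_div_nat_cpow hz]
    exact (Complex.summable_one_div_nat_cpow.mpr hz).hasSum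
  have h2 := HurwitzZeta.hasSum_nat_cosZeta (1 / 2) hz
  have hinj : Function.Injective fun n : ℕ ↦ 2 * n := fun a b h ↦ by simpa using h
  have h3 : HasSum (fun n : ℕ ↦ if Even n then 2 / (n : ℂ) ^ z else 0)
      (2 ^ (1 - z) * riemannZeta z) := by
    rw [← hinj.hasSum_iff]
    · refine (h1.mul_left (2 ^ (1 - z))).congr_fun fun n ↦ ?_
      simp only [Function.comp_apply, even_two, Even.mul_right, if_true]
      push_cast
      rw [show (2 * n : ℂ) ^ z = 2 ^ z * n ^ z from mod_cast natCast_mul_natCast_cpow 2 n z,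
        cpow_sub _ _ two_ne_zero]
      simp
      ring
    · intro n hn
      rw [if_neg]
      rintro ⟨k, rfl⟩
      exact hn ⟨k, by simp [two_mul]⟩
  rw [show -((1 - (2 : ℂ) ^ (1 - z)) * riemannZeta z) =
    2 ^ (1 - z) * riemannZeta z - riemannZeta z by ring]
  refine h2.unique ((h3.sub h1).congr_fun fun n ↦ ?_)
  rw [show 2 * Real.pi * (1 / 2) * (n : ℝ) = (n : ℝ) * Real.pi by ring, Real.cos_nat_mul_pi]
  rcases n.even_or_odd with hn | hn
  · rw [if_pos hn, hn.neg_one_pow]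
    push_cast
    ring
  · rw [if_neg (Nat.not_even_iff_odd.mpr hn), hn.neg_one_pow]
    push_cast
    ring

/-- The Riemann hypothesis is the absence of zeros in the right half of the critical strip. -/
theorem riemannHypothesis_iff_ne_zero_right_half_strip :
    RiemannHypothesis ↔ ∀ s : ℂ, 1 / 2 < s.re → s.re < 1 → riemannZeta s ≠ 0 := by
  constructor
  · intro h s h1 h2 hs
    refine h1.ne' (h s hs ?_ ?_)
    · rintro ⟨n, rfl⟩
      norm_num at h1
      linarith [(Nat.cast_nonneg n : (0 : ℝ) ≤ n)]
    · rintro rfl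
      simp at h2
  · intro h s hs htriv hs1
    have hright : ∀ z : ℂ, 1 / 2 < z.re → riemannZeta z ≠ 0 := fun z hz ↦ by
      rcases lt_or_ge z.re 1 with h1 | h1
      · exact h z hz h1
      · exact riemannZeta_ne_zero_of_one_le_re h1
    rcases lt_trichotomy s.re (1 / 2) with hlt | heq | hgt
    · exfalso
      have hre : 1 / 2 < (1 - s).re := by simp; linarith
      have hpole : ∀ n : ℕ, 1 - s ≠ -n := fun n hn ↦ by
        rw [hn] at hre
        simp at hre
        linarith [(Nat.cast_nonneg n : (0 : ℝ) ≤ n)]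
      have hs0 : s ≠ 0 := by
        rintro rfl
        simp [riemannZeta_zero] at hs
      have hfe := riemannZeta_one_sub hpole (by simpa using hs0)
      rw [sub_sub_cancel, hs] at hfe
      -- Γ and ζ do not vanish at 1 - s, so only the cosine factor can, which makes s a trivial
      -- zero.
      have hcos : Complex.cos (Real.pi * (1 - s) / 2) = 0 := by
        have hπ : (2 * Real.pi : ℂ) ^ (-(1 - s)) ≠ 0 := by
          rw [Ne, cpow_eq_zero_iff]
          simp
        simpa [hπ, Gamma_ne_zero hpole, hright _ hre] using hfe.symm
      obtain ⟨k, hk⟩ := Complex.cos_eq_zero_iff.mp hcos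
      have hsk : s = -2 * k := by
        have hπ : (Real.pi : ℂ) ≠ 0 := by simp
        have : (1 - s) = 2 * k + 1 := by
          apply mul_left_cancel₀ hπ
          linear_combination 2 * hk
        linear_combination -this
      have hk0 : 0 < k := by
        have h3 : (-1 : ℝ) < 2 * k := by
          rw [hsk] at hre
          simp at hre
          linarith
        have h4 : (-1 : ℤ) < 2 * k := by exact_mod_cast h3
        have h5 : k ≠ 0 := by
          rintro rfl
          simp at hsk
          exact hs0 hsk
        omega
      obtain ⟨n, rfl⟩ : ∃ n : ℕ, k = n + 1 := ⟨(k - 1).toNat, by omega⟩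
      exact htriv ⟨n, by rw [hsk]; push_cast; ring⟩
    · exact heq
    · exact absurd hs (hright s hgt)

/-- In the critical strip the zeros of the Mellin transform of `1 / (e^s + 1)` are those of the
zeta function. -/
theorem mellin_fermi_eq_zero_iff {s : ℂ} (h0 : 0 < s.re) (h1 : s.re < 1) :
    mellin fermi s = 0 ↔ riemannZeta s = 0 := by
  have hs1 : s ≠ 1 := by
    rintro rfl
    simp at h1
  -- |2^{1-s}| = 2^{1 - Re s} > 1.
  have hpow : (1 : ℂ) - 2 ^ (1 - s) ≠ 0 := by
    intro h
    have h2 : ‖(2 : ℂ) ^ (1 - s)‖ = 1 := by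
      rw [← sub_eq_zero.mp h, norm_one]
    have h3 := norm_cpow_eq_rpow_re_of_pos two_pos (1 - s)
    push_cast at h3
    rw [h2] at h3
    have h4 := Real.one_lt_rpow one_lt_two (show 0 < (1 - s).re by simpa using h1)
    linarith
  rw [mellin_fermi_eq_cosZeta h0, cosZeta_half_eq hs1]
  simp [hpow, Gamma_ne_zero_of_re_pos h0]

/-! ### The kernel and the double integral -/

/-- The kernel `e^{-δ u} / (e^{e^{-u}} + 1)`. -/
noncomputable def fermiKernel (δ u : ℝ) : ℝ :=
  Real.exp (-δ * u) * (1 / (Real.exp (Real.exp (-u)) + 1))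

theorem ofReal_fermiKernel (δ u : ℝ) :
    (fermiKernel δ u : ℂ) = Real.exp (-δ * u) • fermi (Real.exp (-u)) := by
  rw [fermiKernel, fermi, ofReal_mul, real_smul]

theorem fourier_fermiKernel (δ ξ : ℝ) :
    𝓕 (fun u ↦ (fermiKernel δ u : ℂ)) ξ = mellin fermi (δ + 2 * Real.pi * ξ * I) := by
  rw [mellin_eq_fourier]
  simp only [ofReal_fermiKernel]
  simp

theorem continuous_fermiKernel (δ : ℝ) : Continuous (fermiKernel δ) := by
  unfold fermiKernel
  refine Continuous.mul (by fun_prop) (continuous_const.div (by fun_prop) fun s ↦ ?_)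
  positivity

/-- The substitution t = e^{-u} turns the Mellin integral at s = δ into the integral of the kernel.
-/
theorem integrable_fermiKernel {δ : ℝ} (hδ : 0 < δ) : Integrable (fermiKernel δ) := by
  have h := mellinConvergent_fermi (s := δ) (by simpa using hδ)
  have himg : (fun u : ℝ ↦ Real.exp (-u)) '' univ = Ioi 0 := by
    rw [image_univ]
    exact (neg_surjective.range_comp Real.exp).trans Real.range_exp
  rw [MellinConvergent, ← himg, integrableOn_image_iff_integrableOn_abs_deriv_smul
    MeasurableSet.univ (f' := fun u ↦ -Real.exp (-u))
    (fun u _ ↦ by simpa using (hasDerivAt_neg u).exp)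
    (fun _ _ _ _ h ↦ neg_injective (Real.exp_injective h)), integrableOn_univ] at h
  refine h.re.congr (ae_of_all _ fun u ↦ ?_)
  simp only [abs_neg, abs_of_pos (Real.exp_pos _)]
  rw [← ofReal_one, ← ofReal_sub, ← ofReal_cpow (Real.exp_pos _).le, ← Real.exp_mul, fermi,
    real_smul, smul_eq_mul, ← ofReal_mul, ← ofReal_mul, ← mul_assoc, ← Real.exp_add]
  simp only [RCLike.re_to_complex, ofReal_re, fermiKernel]
  congr 2
  ring

theorem contDiff_fourier_fermiKernel {δ : ℝ} (hδ : 0 < δ) :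
    ContDiff ℝ ∞ (𝓕 fun u ↦ (fermiKernel δ u : ℂ)) := by
  have hU : IsOpen {z : ℂ | 0 < z.re} := isOpen_lt continuous_const continuous_re
  have h : ContDiffOn ℂ ∞ (mellin fermi) {z : ℂ | 0 < z.re} :=
    DifferentiableOn.contDiffOn
      (fun z hz ↦ (differentiableAt_mellin_fermi hz).differentiableWithinAt) hU
  have hline : ContDiff ℝ ∞ fun ξ : ℝ ↦ (δ + 2 * Real.pi * ξ * I : ℂ) :=
    contDiff_const.add ((contDiff_const.mul ofRealCLM.contDiff).mul contDiff_const)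
  have := (h.restrict_scalars ℝ).comp_contDiff hline fun ξ ↦ by simpa using hδ
  convert this using 1
  ext ξ
  exact fourier_fermiKernel δ ξ

/-- The exponential is split along u = x + (-t) + (u - (x - t)). -/
theorem salemWeight_eq (δ x u t : ℝ) : salemWeight δ x u t =
    Real.exp (-δ * x) * (fermiKernel δ (-t) * fermiKernel δ (u - (x - t))) := by
  have h : Real.exp (-δ * u) =
      Real.exp (-δ * x) * (Real.exp (-δ * -t) * Real.exp (-δ * (u - (x - t)))) := by
    rw [← Real.exp_add, ← Real.exp_add]
    congr 1
    ring
  rw [salemWeight, fermiKernel, fermiKernel, h, neg_neg,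
    show -(u - (x - t)) = x - u - t by ring]
  field_simp

theorem integrable_salemWeight {δ : ℝ} (hδ : 0 < δ) (x : ℝ) :
    Integrable fun p : ℝ × ℝ ↦ salemWeight δ x p.1 p.2 := by
  have hb := integrable_fermiKernel hδ
  have h1 : Integrable (fun p : ℝ × ℝ ↦ fermiKernel δ p.2 * fermiKernel δ (p.1 - p.2))
      (volume.prod volume) :=
    hb.convolution_integrand (ContinuousLinearMap.mul ℝ ℝ) hb
  have h2 := (((measurePreserving_sub_right (volume : Measure ℝ) x).prod
    (Measure.measurePreserving_neg (volume : Measure ℝ))).integrable_comp_of_integrable h1).const_mul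
      (Real.exp (-δ * x))
  refine h2.congr (ae_of_all _ fun p ↦ ?_)
  simp only [salemWeight_eq, Function.comp_apply, Prod.map_fst, Prod.map_snd]
  rw [show p.1 - x - -p.2 = p.1 - (x - p.2) by ring]

theorem integrable_salemWeight_mul {𝕜 : Type*} [RCLike 𝕜] {δ : ℝ} (hδ : 0 < δ) {f : ℝ → 𝕜}
    (hf : Measurable f) {C : ℝ} (hC : ∀ u, ‖f u‖ ≤ C) (x : ℝ) :
    Integrable fun p : ℝ × ℝ ↦ (salemWeight δ x p.1 p.2 : 𝕜) * f p.1 :=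
  (integrable_salemWeight hδ x).ofReal.mul_bdd (c := C)
    (hf.comp measurable_fst).aestronglyMeasurable (ae_of_all _ fun p ↦ hC p.1)

/-- The double integral is an iterated correlation with the kernel. -/
theorem integral_salemWeight_mul {δ : ℝ} (hδ : 0 < δ) {h : ℝ → ℝ} (hh : Measurable h) {C : ℝ}
    (hC : ∀ u, ‖h u‖ ≤ C) (x : ℝ) :
    ∫ p : ℝ × ℝ, salemWeight δ x p.1 p.2 * h p.1 = Real.exp (-δ * x) *
      ∫ s, (∫ u, h u * fermiKernel δ (u - s)) * fermiKernel δ (s - x) := by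
  have hint : Integrable (fun p : ℝ × ℝ ↦ salemWeight δ x p.1 p.2 * h p.1)
      (volume.prod volume) := integrable_salemWeight_mul (𝕜 := ℝ) hδ hh hC x
  rw [Measure.volume_eq_prod, integral_prod_symm _ hint, ← integral_sub_left_eq_self _ _ x,
    ← integral_const_mul]
  refine integral_congr_ae (ae_of_all _ fun s ↦ ?_)
  simp only [salemWeight_eq]
  rw [mul_comm (∫ u, _), ← mul_assoc, ← integral_const_mul]
  refine integral_congr_ae (ae_of_all _ fun u ↦ ?_)
  simp only [sub_sub_cancel, neg_sub]
  ring

theorem ae_eq_zero_of_fermiKernel_correlation {δ : ℝ} (h0 : 0 < δ) (h1 : δ < 1)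
    (hζ : ∀ s : ℂ, s.re = δ → riemannZeta s ≠ 0) {h : ℝ → ℝ} (hh : Measurable h) {C : ℝ}
    (hC : ∀ u, ‖h u‖ ≤ C) (hz : ∀ᵐ x, ∫ u, h u * fermiKernel δ (u - x) = 0) :
    ∀ᵐ u, h u = 0 := by
  have key := ae_eq_zero_of_correlation_eq_zero (f := fun u ↦ (h u : ℂ)) (C := C)
    (measurable_ofReal.comp hh) (fun u ↦ by simpa using hC u) (integrable_fermiKernel h0).ofReal
    (contDiff_fourier_fermiKernel h0) (fun ξ ↦ by
      have hre : (δ + 2 * Real.pi * ξ * I : ℂ).re = δ := by simp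
      change 𝓕 (fun u ↦ (fermiKernel δ u : ℂ)) ξ ≠ 0
      rw [fourier_fermiKernel, Ne, mellin_fermi_eq_zero_iff (by rwa [hre]) (by rwa [hre])]
      exact hζ _ hre)
    (by
      filter_upwards [hz] with x hx
      have : (∫ u, ((h u * fermiKernel δ (u - x) : ℝ) : ℂ)) = 0 := by
        rw [integral_complex_ofReal, hx, ofReal_zero]
      simpa using this)
  filter_upwards [key] with u hu
  exact_mod_cast hu

/-- The correlation of h with the kernel is itself bounded and measurable, so Wiener's theorem
applies to it and then to h. -/
theorem ae_eq_zero_of_integral_salemWeight_mul {δ : ℝ} (h0 : 0 < δ) (h1 : δ < 1)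
    (hζ : ∀ s : ℂ, s.re = δ → riemannZeta s ≠ 0) {h : ℝ → ℝ} (hh : Measurable h) {C : ℝ}
    (hC : ∀ u, ‖h u‖ ≤ C) (hz : ∀ x, ∫ p : ℝ × ℝ, salemWeight δ x p.1 p.2 * h p.1 = 0) :
    ∀ᵐ u, h u = 0 := by
  have hb := integrable_fermiKernel h0
  refine ae_eq_zero_of_fermiKernel_correlation h0 h1 hζ hh hC
    (ae_eq_zero_of_fermiKernel_correlation h0 h1 hζ
      (h := fun s ↦ ∫ u, h u * fermiKernel δ (u - s)) (C := C * ∫ u, ‖fermiKernel δ u‖) ?_ ?_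
      (ae_of_all _ fun x ↦ ?_))
  · have hm : Measurable fun p : ℝ × ℝ ↦ h p.2 * fermiKernel δ (p.2 - p.1) :=
      (hh.comp measurable_snd).mul ((continuous_fermiKernel δ).measurable.comp
        (measurable_snd.sub measurable_fst))
    exact hm.stronglyMeasurable.integral_prod_right.measurable
  · intro s
    rw [← integral_sub_right_eq_self (fun u ↦ ‖fermiKernel δ u‖) s, ← integral_const_mul]
    refine norm_integral_le_of_norm_le ((hb.comp_sub_right s).norm.const_mul C)
      (ae_of_all _ fun u ↦ ?_)
    rw [norm_mul]
    gcongr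
    exact hC u
  · have := hz x
    rw [integral_salemWeight_mul h0 hh hC] at this
    exact (mul_eq_zero.mp this).resolve_left (Real.exp_pos _).ne'

/-- At a zero of the zeta function a cosine is annihilated by the kernel. -/
theorem integral_cos_mul_fermiKernel {z : ℂ} (h0 : 0 < z.re) (h1 : z.re < 1)
    (hz : riemannZeta z = 0) (s : ℝ) :
    ∫ u, Real.cos (z.im * u) * fermiKernel z.re (u - s) = 0 := by
  have hb := (integrable_fermiKernel h0).ofReal (𝕜 := ℂ)
  -- At this frequency δ + 2πiξ is z itself.
  have hF : 𝓕 (fun u ↦ (fermiKernel z.re u : ℂ)) (z.im / (2 * Real.pi)) = 0 := by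
    rw [fourier_fermiKernel, show (z.re + 2 * Real.pi * ((z.im / (2 * Real.pi) : ℝ) : ℂ) * I : ℂ) = z
      by
        conv_rhs => rw [← re_add_im z]
        push_cast
        field_simp]
    exact (mellin_fermi_eq_zero_iff h0 h1).mpr hz
  rw [Real.fourier_eq'] at hF
  have hG : ∫ v : ℝ, cexp (↑(-(z.im * (v + s))) * I) * (fermiKernel z.re v : ℂ) = 0 := by
    rw [← mul_zero (cexp (↑(-(z.im * s)) * I)), ← hF, ← integral_const_mul]
    refine integral_congr_ae (ae_of_all _ fun v ↦ ?_)
    simp only [smul_eq_mul]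
    rw [← mul_assoc, ← Complex.exp_add]
    congr 2
    simp
    field_simp
    ring
  have hint : Integrable fun v : ℝ ↦
      cexp (↑(-(z.im * (v + s))) * I) * (fermiKernel z.re v : ℂ) := by
    refine hb.bdd_mul (c := 1) (by fun_prop) (ae_of_all _ fun v ↦ ?_)
    rw [Complex.norm_exp_ofReal_mul_I]
  have hre := (reCLM.integral_comp_comm hint).trans (congrArg _ hG)
  rw [← integral_add_right_eq_self _ s]
  simp only [map_zero] at hre
  rw [← hre]
  refine integral_congr_ae (ae_of_all _ fun v ↦ ?_)
  simp only [add_sub_cancel_right, reCLM_apply, re_mul_ofReal, exp_ofReal_mul_I_re, Real.cos_neg]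

/-! ### The equivalence -/

theorem theorem7 {𝕜 : Type*} [RCLike 𝕜] :
    (∀ δ : ℝ, 1 / 2 < δ → δ < 1 → ∀ f : ℝ → 𝕜, Measurable f → (∃ C : ℝ, ∀ u, ‖f u‖ ≤ C) →
      ∀ x : ℝ, MeasureTheory.Integrable
        (fun p : ℝ × ℝ => (salemWeight δ x p.1 p.2 : 𝕜) * f p.1) MeasureTheory.volume) ∧
    (RiemannHypothesis ↔
      ∀ δ : ℝ, 1 / 2 < δ → δ < 1 → ∀ f : ℝ → 𝕜, Measurable f → (∃ C : ℝ, ∀ u, ‖f u‖ ≤ C) →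
        (∀ x : ℝ, ∫ p : ℝ × ℝ, (salemWeight δ x p.1 p.2 : 𝕜) * f p.1 = 0) →
        ∀ᵐ u : ℝ, f u = 0) := by
  refine ⟨fun δ hδ _ f hf ⟨C, hC⟩ x ↦ integrable_salemWeight_mul (by linarith) hf hC x, ?_⟩
  rw [riemannHypothesis_iff_ne_zero_right_half_strip]
  constructor
  · rintro hζ δ hδ hδ1 f hf ⟨C, hC⟩ hz
    have h0 : 0 < δ := by linarith
    have hζδ : ∀ s : ℂ, s.re = δ → riemannZeta s ≠ 0 := fun s hs ↦
      hζ s (by rwa [hs]) (by rwa [hs])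
    -- The weight is real, so the real and imaginary parts of f solve the equation separately.
    have hre : ∀ᵐ u, RCLike.re (f u) = 0 := by
      refine ae_eq_zero_of_integral_salemWeight_mul h0 hδ1 hζδ (RCLike.measurable_re.comp hf)
        (fun u ↦ (RCLike.norm_re_le_norm (f u)).trans (hC u)) fun x ↦ ?_
      have := RCLike.reCLM.integral_comp_comm (integrable_salemWeight_mul h0 hf hC x)
      rw [hz x, map_zero] at this
      simpa using this
    have him : ∀ᵐ u, RCLike.im (f u) = 0 := by
      refine ae_eq_zero_of_integral_salemWeight_mul h0 hδ1 hζδ (RCLike.measurable_im.comp hf)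
        (fun u ↦ (RCLike.norm_im_le_norm (f u)).trans (hC u)) fun x ↦ ?_
      have := RCLike.imCLM.integral_comp_comm (integrable_salemWeight_mul h0 hf hC x)
      rw [hz x, map_zero] at this
      simpa using this
    filter_upwards [hre, him] with u h1 h2
    exact RCLike.ext (by simpa using h1) (by simpa using h2)
  · intro H z hz hz1 hzero
    have h0 : 0 < z.re := by linarith
    have hcos : Continuous fun u : ℝ ↦ Real.cos (z.im * u) := by fun_prop
    have hbound : ∀ u : ℝ, ‖Real.cos (z.im * u)‖ ≤ 1 := fun u ↦ Real.abs_cos_le_one _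
    have hcont : Continuous fun u : ℝ ↦ ((Real.cos (z.im * u) : ℝ) : 𝕜) :=
      RCLike.continuous_ofReal.comp hcos
    have hae := H z.re hz hz1 (fun u ↦ ((Real.cos (z.im * u) : ℝ) : 𝕜)) hcont.measurable
      ⟨1, fun u ↦ by simpa using hbound u⟩ fun x ↦ by
        simp only [← RCLike.ofReal_mul]
        rw [integral_ofReal, integral_salemWeight_mul h0 hcos.measurable hbound]
        simp [integral_cos_mul_fermiKernel h0 hz1 hzero]
    -- By continuity the cosine would vanish everywhere, yet it is 1 at 0.
    have hfun := (hcont.ae_eq_iff_eq volume continuous_const).mp hae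
    have := congrFun hfun 0
    simp at this
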